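/- Let $d\ge 1$, let $\Omega\subset\mathbb R^d$ be an open, connected, bounded set with Lipschitz boundary, and let $K\colon\mathbb R^d\to[0,+\infty)$ be a (Lebesgue) measurable even function such that $$c'_K:=\int_{\mathbb R^d}K(h)\,|h|\,dh<+\infty .$$ For a measurable function $u$ (on $\Omega$ for $J^1_K$, on $\mathbb R^d$ for $J^2_K$ and $J_K$) put $$J_K^1(u,\Omega):=\int_\Omega\int_\Omega K(y-x)|u(y)-u(x)|\,dx\,dy,\qquad J_K^2(u,\Omega):=\int_\Omega\int_{\mathbb R^d\setminus\Omega} K(y-x)|u(y)-u(x)|\,dx\,dy,$$ $$J_K(u,\Omega):=\tfrac12 J_K^1(u,\Omega)+J_K^2(u,\Omega).$$ For an open set $A\subset\mathbb R^d$ and $u\in L^1(A)$ let $$|Du|(A):=\sup\Big\{\int_A u\,\operatorname{div}\varphi\,dx : \varphi\in C_c^\infty(A;\mathbb R^d),\ |\varphi|\le1\Big\}\in[0,+\infty]$$ be the total variation in $A$ of the distributional gradient of $u$, and let $BV(A):=\{u\in L^1(A): |Du|(A)<+\infty\}$. Then: 1. If $\Omega$ is convex and $u\in BV(\Omega)$,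 then $J_K^1(u,\Omega)\le c'_K\,|Du|(\Omega)$. 2. If $u\in C^1(\mathbb R^d)\cap BV(\mathbb R^d)$, then $J_K(u,\Omega)\le c'_K\int_{\mathbb R^d}|\nabla u|\,dx$. 3. If $u\in BV(\mathbb R^d)$, then $J_K(u,\Omega)\le c'_K\,|Du|(\mathbb R^d)$. -/

import Mathlib

open MeasureTheory Set Metric
open scoped ENNReal NNReal ContDiff

noncomputable section

/-- The boundary of `Ω ⊆ ℝ^d` is Lipschitz: near each of its points, `Ω` is, in suitable
orthonormal coordinates, the region strictly below the graph of a Lipschitz function. Here `ν` is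
the vertical unit direction, and `g` is a function of the remaining `d - 1` coordinates, that is,
a function on the orthogonal complement of `ν`. -/
def HasLipschitzBoundary {d : ℕ} (Ω : Set (EuclideanSpace ℝ (Fin d))) : Prop :=
  ∀ x ∈ frontier Ω, ∃ r : ℝ, 0 < r ∧ ∃ ν : EuclideanSpace ℝ (Fin d), ‖ν‖ = 1 ∧
    ∃ g : (Submodule.span ℝ {ν})ᗮ → ℝ, (∃ L : ℝ≥0, LipschitzWith L g) ∧
      ∀ y ∈ ball x r,
        (y ∈ Ω ↔ inner ℝ ν y < g ((Submodule.span ℝ {ν})ᗮ.orthogonalProjectionOnto y))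

/-- Open, connected, bounded sets with Lipschitz boundary. -/
structure IsLipschitzDomain {d : ℕ} (Ω : Set (EuclideanSpace ℝ (Fin d))) : Prop where
  isOpen : IsOpen Ω
  isConnected : IsConnected Ω
  isBounded : Bornology.IsBounded Ω
  lipschitzBoundary : HasLipschitzBoundary Ω

/-- The first moment `∫ K(h) |h| dh` of the kernel. -/
def firstMoment {d : ℕ} (K : EuclideanSpace ℝ (Fin d) → ℝ≥0) : ℝ≥0∞ :=
  ∫⁻ h, (K h : ℝ≥0∞) * ‖h‖ₑ

/-- Lebesgue measurable, even kernels with values in `[0, ∞)` and finite first moment.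
(For the completed Lebesgue measure, Lebesgue measurability is almost everywhere
measurability.) -/
structure IsAdmissibleKernel {d : ℕ} (K : EuclideanSpace ℝ (Fin d) → ℝ≥0) : Prop where
  aemeasurable : AEMeasurable K volume
  even : ∀ h, K (-h) = K h
  firstMoment_ne_top : firstMoment K ≠ ⊤

/-- `∫_Ω ∫_Ω K(y - x) |u(y) - u(x)| dx dy`. -/
def nonlocalEnergy1 {d : ℕ} (K : EuclideanSpace ℝ (Fin d) → ℝ≥0)
    (u : EuclideanSpace ℝ (Fin d) → ℝ) (Ω : Set (EuclideanSpace ℝ (Fin d))) : ℝ≥0∞ :=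
  ∫⁻ y in Ω, ∫⁻ x in Ω, (K (y - x) : ℝ≥0∞) * ‖u y - u x‖ₑ

/-- `∫_Ω ∫_{Ωᶜ} K(y - x) |u(y) - u(x)| dx dy`. -/
def nonlocalEnergy2 {d : ℕ} (K : EuclideanSpace ℝ (Fin d) → ℝ≥0)
    (u : EuclideanSpace ℝ (Fin d) → ℝ) (Ω : Set (EuclideanSpace ℝ (Fin d))) : ℝ≥0∞ :=
  ∫⁻ y in Ω, ∫⁻ x in Ωᶜ, (K (y - x) : ℝ≥0∞) * ‖u y - u x‖ₑ

/-- The nonlocal `K`-energy of `u` in `Ω`. -/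
def nonlocalEnergy {d : ℕ} (K : EuclideanSpace ℝ (Fin d) → ℝ≥0)
    (u : EuclideanSpace ℝ (Fin d) → ℝ) (Ω : Set (EuclideanSpace ℝ (Fin d))) : ℝ≥0∞ :=
  (1 / 2) * nonlocalEnergy1 K u Ω + nonlocalEnergy2 K u Ω

/-- The divergence of a vector field on `ℝ^d`. -/
def divergence {d : ℕ} (φ : EuclideanSpace ℝ (Fin d) → EuclideanSpace ℝ (Fin d))
    (x : EuclideanSpace ℝ (Fin d)) : ℝ :=
  ∑ i, (fderiv ℝ φ x (EuclideanSpace.single i 1)) i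

/-- Smooth vector fields, compactly supported in `Ω`, of Euclidean length at most one. -/
structure IsTestField {d : ℕ} (Ω : Set (EuclideanSpace ℝ (Fin d)))
    (φ : EuclideanSpace ℝ (Fin d) → EuclideanSpace ℝ (Fin d)) : Prop where
  contDiff : ContDiff ℝ ((⊤ : ℕ∞) : ℕ∞ω) φ
  hasCompactSupport : HasCompactSupport φ
  tsupport_subset : tsupport φ ⊆ Ω
  norm_le_one : ∀ x, ‖φ x‖ ≤ 1

/-- The total variation `|Du|(Ω)` in `[0, ∞]` of the distributional gradient of `u` in the open
set `Ω`, i.e. the supremum of `∫_Ω u div φ` over all test fields `φ` (`φ = 0` is one of them, so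
negative values play no role). It is meant for `u` integrable on `Ω` and depends only on `u`
inside `Ω`. -/
def totalVariation {d : ℕ} (u : EuclideanSpace ℝ (Fin d) → ℝ)
    (Ω : Set (EuclideanSpace ℝ (Fin d))) : ℝ≥0∞ :=
  ⨆ (φ : EuclideanSpace ℝ (Fin d) → EuclideanSpace ℝ (Fin d)) (_ : IsTestField Ω φ),
    ENNReal.ofReal (∫ x in Ω, u x * divergence φ x)

/-- `u ∈ BV(Ω)`: `u ∈ L¹(Ω)` and `|Du|(Ω) < ∞`. The values of `u` outside `Ω` are irrelevant. -/
structure IsBV {d : ℕ} (u : EuclideanSpace ℝ (Fin d) → ℝ)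
    (Ω : Set (EuclideanSpace ℝ (Fin d))) : Prop where
  integrableOn : IntegrableOn u Ω volume
  totalVariation_ne_top : totalVariation u Ω ≠ ⊤

end

/-!
Substituting `y = x + h` and using Tonelli,
`J¹_K(u, U) = ∫ K(h) ‖u(· + h) - u‖_{L¹(U ∩ (U - h))} dh`, so for convex `U` everything rests on
`‖u(· + h) - u‖_{L¹(U ∩ (U - h))} ≤ |h| |Du|(U)`. By duality this `L¹` norm is the supremum of
`∫ (u(· + h) - u) ψ` over smooth `ψ` with `|ψ| ≤ 1`, compactly supported in `U ∩ (U - h)`. Moving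
the translation onto `ψ` gives `∫ u (ψ(· - h) - ψ)`, and `ψ - ψ(· - h)` is the derivative in the
direction `h` of the average of `ψ` over the segments `[x - h, x]`. Convexity keeps this average
supported in `U`, so that, multiplied by `-h / |h|`, it is an admissible field for `|Du|(U)`.

On the whole space `J_K(u, Ω) ≤ J¹_K(u, ℝ^d)`, and for `u` of class `C¹` integration by parts gives
`|Du|(ℝ^d) ≤ ∫ |∇u|`.
-/

section TestFunctions

variable {E : Type*} [NormedAddCommGroup E] [NormedSpace ℝ E] {U V : Set E} {ψ : E → ℝ}

/-- Smooth functions, compactly supported in `V`, with values in `[-1, 1]`: the scalar analogue of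
`IsTestField`. -/
structure IsTestFunction (V : Set E) (ψ : E → ℝ) : Prop where
  contDiff : ContDiff ℝ ∞ ψ
  hasCompactSupport : HasCompactSupport ψ
  tsupport_subset : tsupport ψ ⊆ V
  abs_le_one : ∀ x, |ψ x| ≤ 1

namespace IsTestFunction

lemma mono (hψ : IsTestFunction U ψ) (hUV : U ⊆ V) : IsTestFunction V ψ :=
  { hψ with tsupport_subset := hψ.tsupport_subset.trans hUV }

lemma eq_zero_of_notMem (hψ : IsTestFunction V ψ) {x : E} (hx : x ∉ V) : ψ x = 0 :=
  image_eq_zero_of_notMem_tsupport fun h ↦ hx (hψ.tsupport_subset h)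

end IsTestFunction

variable [FiniteDimensional ℝ E]

open scoped Manifold in
lemma exists_isTestFunction_eqOn_one {A : Set E} (hA : IsCompact A) (hV : IsOpen V)
    (hAV : A ⊆ V) : ∃ f : E → ℝ, IsTestFunction V f ∧ EqOn f 1 A ∧ ∀ x, 0 ≤ f x := by
  obtain ⟨L, hL, hAL, hLV⟩ := exists_compact_between hA hV hAV
  obtain ⟨f, hf_one, hf_zero, hf⟩ :=
    exists_contMDiffMap_one_nhds_of_subset_interior (n := ⊤) 𝓘(ℝ, E) hA.isClosed hAL
  have hfL : tsupport f ⊆ L :=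
    closure_minimal (fun x hx ↦ by_contra fun h ↦ hx (hf_zero x h)) hL.isClosed
  refine ⟨f, ⟨f.contMDiff.contDiff, hL.of_isClosed_subset (isClosed_tsupport _) hfL,
    hfL.trans hLV, fun x ↦ ?_⟩, fun x hx ↦ hf_one.self_of_nhdsSet x hx, fun x ↦ (hf x).1⟩
  exact abs_le.2 ⟨by linarith [(hf x).1], (hf x).2⟩

lemma exists_isTestFunction_eqOn_one_eqOn_neg_one {A B : Set E} (hA : IsCompact A)
    (hB : IsCompact B) (hAB : Disjoint A B) (hV : IsOpen V) (hAV : A ⊆ V) (hBV : B ⊆ V) :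
    ∃ ψ : E → ℝ, IsTestFunction V ψ ∧ EqOn ψ 1 A ∧ EqOn ψ (-1) B := by
  obtain ⟨f, hf, hfA, hf_nonneg⟩ := exists_isTestFunction_eqOn_one hA
    (hV.sdiff hB.isClosed) (subset_sdiff.2 ⟨hAV, hAB⟩)
  obtain ⟨g, hg, hgB, hg_nonneg⟩ := exists_isTestFunction_eqOn_one hB
    (hV.sdiff hA.isClosed) (subset_sdiff.2 ⟨hBV, hAB.symm⟩)
  refine ⟨f - g, ⟨hf.contDiff.sub hg.contDiff, hf.hasCompactSupport.sub hg.hasCompactSupport,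
    (tsupport_sub f g).trans (union_subset (hf.tsupport_subset.trans sdiff_subset)
      (hg.tsupport_subset.trans sdiff_subset)), fun x ↦ ?_⟩, fun x hx ↦ ?_, fun x hx ↦ ?_⟩
  · exact abs_sub_le_of_nonneg_of_le (hf_nonneg x) ((le_abs_self _).trans (hf.abs_le_one x))
      (hg_nonneg x) ((le_abs_self _).trans (hg.abs_le_one x))
  · simp [hfA hx, hg.eq_zero_of_notMem fun h ↦ h.2 hx]
  · simp [hgB hx, hf.eq_zero_of_notMem fun h ↦ h.2 hx]

end TestFunctions

section Duality

lemma integrable_mul_of_tsupport_subset {X : Type*} [TopologicalSpace X] [T2Space X]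
    [MeasurableSpace X] [OpensMeasurableSpace X] {μ : Measure X} {U : Set X} {w g : X → ℝ}
    (hw : LocallyIntegrableOn w U μ) (hg : Continuous g) (hgc : HasCompactSupport g)
    (hgU : tsupport g ⊆ U) : Integrable (fun x ↦ w x * g x) μ := by
  rw [← integrableOn_iff_integrable_of_support_subset
    ((Function.support_mul_subset_right w g).trans (subset_tsupport g))]
  have hw' : IntegrableOn w (tsupport g) μ := hw.integrableOn_compact_subset hgU hgc
  exact hw'.mul_continuousOn hg.continuousOn hgc

lemma lintegral_enorm_le_ofReal_integral_mul_add {X : Type*} [MeasurableSpace X] {μ : Measure X}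
    {w ψ : X → ℝ} (hw : Integrable w μ) (hψ : AEStronglyMeasurable ψ μ) (hψ_le : ∀ x, |ψ x| ≤ 1) :
    ∫⁻ x, ‖w x‖ₑ ∂μ ≤ ENNReal.ofReal (∫ x, w x * ψ x ∂μ) +
      2 * ∫⁻ x in {x | w x * ψ x ≠ |w x|}, ‖w x‖ₑ ∂μ := by
  set D := {x | w x * ψ x ≠ |w x|}
  have hwψ : Integrable (fun x ↦ w x * ψ x) μ := hw.mul_bdd (c := 1) hψ (.of_forall hψ_le)
  have hdefect : ∀ x, |w x| - w x * ψ x ≤ 2 * |w x| := fun x ↦ by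
    have : |w x * ψ x| ≤ |w x| := by
      rw [abs_mul]
      exact mul_le_of_le_one_right (abs_nonneg _) (hψ_le x)
    linarith [neg_abs_le (w x * ψ x)]
  have hsplit : ∫ x, |w x| ∂μ ≤ ∫ x, w x * ψ x ∂μ + 2 * ∫ x in D, |w x| ∂μ :=
    calc ∫ x, |w x| ∂μ = ∫ x, w x * ψ x ∂μ + ∫ x, (|w x| - w x * ψ x) ∂μ := by
          rw [integral_sub hw.abs hwψ, add_sub_cancel]
      _ = ∫ x, w x * ψ x ∂μ + ∫ x in D, (|w x| - w x * ψ x) ∂μ := by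
          rw [setIntegral_eq_integral_of_forall_compl_eq_zero fun x hx ↦ ?_]
          rw [not_not.1 hx, sub_self]
      _ ≤ ∫ x, w x * ψ x ∂μ + ∫ x in D, 2 * |w x| ∂μ := by
          exact add_le_add le_rfl (integral_mono (hw.abs.sub hwψ).integrableOn
            (hw.abs.const_mul 2).integrableOn hdefect)
      _ = ∫ x, w x * ψ x ∂μ + 2 * ∫ x in D, |w x| ∂μ := by rw [integral_const_mul]
  simp only [← Real.norm_eq_abs] at hsplit
  rw [← ofReal_integral_norm_eq_lintegral_enorm hw,
    ← ofReal_integral_norm_eq_lintegral_enorm hw.integrableOn, ← ENNReal.ofReal_ofNat 2,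
    ← ENNReal.ofReal_mul zero_le_two]
  exact (ENNReal.ofReal_le_ofReal hsplit).trans ENNReal.ofReal_add_le

variable {E : Type*} [NormedAddCommGroup E] [NormedSpace ℝ E] [FiniteDimensional ℝ E]
  [MeasurableSpace E] [BorelSpace E] {V : Set E} {w : E → ℝ}

lemma exists_isTestFunction_measure_mul_ne_abs_le {ν : Measure E} [IsFiniteMeasure ν]
    (hV : IsOpen V) (hw : AEMeasurable w ν) {ε : ℝ≥0∞} (hε : ε ≠ 0) :
    ∃ ψ : E → ℝ, IsTestFunction V ψ ∧ ν (V ∩ {x | w x * ψ x ≠ |w x|}) ≤ ε := by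
  set v := hw.mk w
  have hv : Measurable v := hw.measurable_mk
  have hε' : ε / 2 ≠ 0 := by simpa using hε
  obtain ⟨A, hAV, hA, hνA⟩ :=
    (hV.measurableSet.inter (measurableSet_lt measurable_const hv)).exists_isCompact_sdiff_lt
      (measure_ne_top ν (V ∩ {x | 0 < v x})) hε'
  obtain ⟨B, hBV, hB, hνB⟩ :=
    (hV.measurableSet.inter (measurableSet_lt hv measurable_const)).exists_isCompact_sdiff_lt
      (measure_ne_top ν (V ∩ {x | v x < 0})) hε'
  have hAB : Disjoint A B := Set.disjoint_left.2 fun x hxA hxB ↦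
    lt_asymm (mem_ofPred.1 (hAV hxA).2) (mem_ofPred.1 (hBV hxB).2)
  obtain ⟨ψ, hψ, hψA, hψB⟩ := exists_isTestFunction_eqOn_one_eqOn_neg_one hA hB hAB hV
    (hAV.trans inter_subset_left) (hBV.trans inter_subset_left)
  have hsubset : V ∩ {x | w x * ψ x ≠ |w x|} ⊆
      {x | w x ≠ v x} ∪ ((V ∩ {x | 0 < v x}) \ A ∪ (V ∩ {x | v x < 0}) \ B) := by
    rintro x ⟨hxV, hx⟩
    by_contra! hxD
    simp only [mem_union, mem_sdiff, mem_inter_iff, mem_ofPred, not_or, not_and, not_not] at hxD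
    obtain ⟨hwv, hpos, hneg⟩ := hxD
    rcases lt_trichotomy (v x) 0 with h | h | h
    · exact hx (by simp [hwv, hψB (hneg ⟨hxV, h⟩), abs_of_neg h])
    · exact hx (by simp [hwv, h])
    · exact hx (by simp [hwv, hψA (hpos ⟨hxV, h⟩), abs_of_pos h])
  refine ⟨ψ, hψ, (measure_mono hsubset).trans ?_⟩
  calc _ ≤ ν {x | w x ≠ v x} + (ν ((V ∩ {x | 0 < v x}) \ A) + ν ((V ∩ {x | v x < 0}) \ B)) :=
        (measure_union_le _ _).trans (add_le_add le_rfl (measure_union_le _ _))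
    _ ≤ 0 + (ε / 2 + ε / 2) := by
        gcongr
        exact (ae_iff.1 hw.ae_eq_mk).le
    _ = ε := by rw [zero_add, ENNReal.add_halves]

lemma setLIntegral_enorm_le_of_forall_isTestFunction_of_integrableOn {μ : Measure E}
    (hV : IsOpen V) (hw : IntegrableOn w V μ) {C : ℝ≥0∞}
    (hC : ∀ ψ, IsTestFunction V ψ → ENNReal.ofReal (∫ x in V, w x * ψ x ∂μ) ≤ C) :
    ∫⁻ x in V, ‖w x‖ₑ ∂μ ≤ C := by
  set ν := (μ.restrict V).withDensity fun x ↦ ‖w x‖ₑ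
  have : IsFiniteMeasure ν := isFiniteMeasure_withDensity hw.2.ne
  have hwν : AEMeasurable w ν := hw.aemeasurable.mono_ac (withDensity_absolutelyContinuous _ _)
  refine ENNReal.le_of_forall_pos_le_add fun ε hε _ ↦ ?_
  obtain ⟨ψ, hψ, hνψ⟩ := exists_isTestFunction_measure_mul_ne_abs_le hV hwν
    (ε := ε / 2) (by simpa using hε.ne')
  set D := {x | w x * ψ x ≠ |w x|}
  have hνD : ∫⁻ x in D, ‖w x‖ₑ ∂μ.restrict V ≤ ε / 2 :=
    calc ∫⁻ x in D, ‖w x‖ₑ ∂μ.restrict V = ∫⁻ x in V ∩ D, ‖w x‖ₑ ∂μ.restrict V := by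
          simp only [Measure.restrict_restrict' hV.measurableSet, inter_comm V D, inter_assoc,
            inter_self]
      _ ≤ ν (V ∩ D) := withDensity_apply_le _ _
      _ ≤ ε / 2 := hνψ
  calc ∫⁻ x in V, ‖w x‖ₑ ∂μ
      ≤ ENNReal.ofReal (∫ x in V, w x * ψ x ∂μ) + 2 * ∫⁻ x in D, ‖w x‖ₑ ∂μ.restrict V :=
        lintegral_enorm_le_ofReal_integral_mul_add hw
          hψ.contDiff.continuous.aestronglyMeasurable hψ.abs_le_one
    _ ≤ C + 2 * (ε / 2) := by gcongr; exact hC ψ hψ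
    _ = C + ε := by rw [ENNReal.mul_div_cancel two_ne_zero ENNReal.ofNat_ne_top]

lemma setLIntegral_enorm_le_of_forall_isTestFunction {μ : Measure E} (hV : IsOpen V)
    (hw : LocallyIntegrableOn w V μ) {C : ℝ≥0∞}
    (hC : ∀ ψ, IsTestFunction V ψ → ENNReal.ofReal (∫ x in V, w x * ψ x ∂μ) ≤ C) :
    ∫⁻ x in V, ‖w x‖ₑ ∂μ ≤ C := by
  obtain ⟨O, hO, hVO, hwO⟩ := hw.exists_nat_integrableOn
  set W : ℕ → Set E := accumulate fun n ↦ O n ∩ V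
  have hW_open (n : ℕ) : IsOpen (W n) := isOpen_biUnion fun k _ ↦ (hO k).inter hV
  have hWV (n : ℕ) : W n ⊆ V := iUnion₂_subset fun _ _ ↦ inter_subset_right
  have hW_int (n : ℕ) : IntegrableOn w (W n) μ :=
    (integrableOn_finite_biUnion (finite_le_nat n)).2 fun k _ ↦ hwO k
  have hV_eq : V = ⋃ n, W n := by
    rw [iUnion_accumulate, ← iUnion_inter, inter_eq_right.2 hVO]
  rw [hV_eq, setLIntegral_iUnion_of_directed _ monotone_accumulate.directed_le]
  refine iSup_le fun n ↦
    setLIntegral_enorm_le_of_forall_isTestFunction_of_integrableOn (hW_open n) (hW_int n)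
      fun ψ hψ ↦ ?_
  have hψ_zero (x : E) (hx : x ∉ W n) : w x * ψ x = 0 := by
    rw [hψ.eq_zero_of_notMem hx, mul_zero]
  rw [setIntegral_eq_integral_of_forall_compl_eq_zero hψ_zero,
    ← setIntegral_eq_integral_of_forall_compl_eq_zero fun x hx ↦ hψ_zero x fun h ↦ hx (hWV n h)]
  exact hC ψ (hψ.mono (hWV n))

end Duality

section SegmentAverage

open scoped Pointwise

variable {E : Type*} [NormedAddCommGroup E] [NormedSpace ℝ E] {h : E} {ψ : E → ℝ}

/-- The average of `ψ` over the segment from `x - h` to `x`. It is a primitive of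
`x ↦ ψ x - ψ (x - h)` in the direction `h`, so it turns a difference quotient of a test function
into a directional derivative of one. -/
noncomputable def segmentAverage (h : E) (ψ : E → ℝ) (x : E) : ℝ :=
  ∫ t in (0 : ℝ)..1, ψ (x - t • h)

lemma segmentAverage_add_smul (h : E) (ψ : E → ℝ) (x : E) (s : ℝ) :
    segmentAverage h ψ (x + s • h) = ∫ r in (s - 1)..s, ψ (x + r • h) := by
  have hsub := intervalIntegral.integral_comp_sub_left (a := 0) (b := 1)
    (fun r : ℝ ↦ ψ (x + r • h)) s
  rw [sub_zero] at hsub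
  rw [← hsub, segmentAverage]
  simp only [sub_smul, add_sub_assoc]

lemma hasLineDerivAt_segmentAverage (hψ : Continuous ψ) (x : E) :
    HasLineDerivAt ℝ (segmentAverage h ψ) (ψ x - ψ (x - h)) x h := by
  have hline : Continuous fun r : ℝ ↦ ψ (x + r • h) := by fun_prop
  have hFTC (s : ℝ) : HasDerivAt (fun s ↦ ∫ r in (0 : ℝ)..s, ψ (x + r • h)) (ψ (x + s • h)) s :=
    hline.integral_hasStrictDerivAt 0 s |>.hasDerivAt
  have hderiv := (hFTC 0).sub ((hFTC (0 - 1)).comp_sub_const 0 1)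
  rw [zero_smul, add_zero, zero_sub, neg_one_smul, ← sub_eq_add_neg] at hderiv
  refine hderiv.congr_of_eventuallyEq (.of_forall fun s ↦ ?_)
  exact (segmentAverage_add_smul h ψ x s).trans (intervalIntegral.integral_interval_sub_left
    (hline.intervalIntegrable _ _) (hline.intervalIntegrable _ _)).symm

lemma abs_segmentAverage_le {C : ℝ} (hψ : ∀ x, |ψ x| ≤ C) (x : E) :
    |segmentAverage h ψ x| ≤ C := by
  simpa [segmentAverage] using intervalIntegral.norm_integral_le_of_norm_le_const (a := 0) (b := 1)
    (f := fun t : ℝ ↦ ψ (x - t • h)) fun t _ ↦ hψ _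

lemma isCompact_segment (x y : E) : IsCompact (segment ℝ x y) := by
  rw [← convexHull_pair]
  exact (toFinite _).isCompact_convexHull ℝ

lemma tsupport_segmentAverage_subset (hψ : HasCompactSupport ψ) :
    tsupport (segmentAverage h ψ) ⊆ tsupport ψ + segment ℝ 0 h := by
  refine closure_minimal (fun x hx ↦ by_contra fun hxS ↦ hx ?_)
    (hψ.isCompact.add (isCompact_segment 0 h)).isClosed
  refine intervalIntegral.integral_zero_ae (.of_forall fun t ht ↦ ?_)
  rw [uIoc_of_le zero_le_one] at ht
  by_contra hne
  refine hxS ⟨x - t • h, subset_tsupport ψ hne, t • h, ?_, sub_add_cancel _ _⟩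
  rw [segment_eq_image']
  exact ⟨t, Ioc_subset_Icc_self ht, by simp⟩

lemma contDiff_segmentAverage [FiniteDimensional ℝ E] {n : ℕ∞} (hψ : ContDiff ℝ n ψ)
    (hψc : HasCompactSupport ψ) : ContDiff ℝ n (segmentAverage h ψ) := by
  borelize E
  -- The segment average is the convolution with the uniform measure on the segment `[0, h]`.
  set σ : Measure E := (volume.restrict (Ioc (0 : ℝ) 1)).map fun t ↦ t • h
  have hsmul : Measurable fun t : ℝ ↦ t • h := by fun_prop
  have : IsFiniteMeasure σ := Measure.isFiniteMeasure_map _ _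
  have hconv : segmentAverage h ψ =
      convolution (fun _ : E ↦ (1 : ℝ)) ψ (ContinuousLinearMap.mul ℝ ℝ) σ := by
    ext x
    have hψx : Continuous fun y ↦ ψ (x - y) := hψ.continuous.comp (by fun_prop)
    simp only [convolution, ContinuousLinearMap.mul_apply', one_mul]
    rw [integral_map hsmul.aemeasurable hψx.aestronglyMeasurable, segmentAverage,
      intervalIntegral.integral_of_le zero_le_one]
  rw [hconv]
  exact hψc.contDiff_convolution_right _ (integrable_const _).locallyIntegrable hψ

lemma IsTestFunction.segmentAverage [FiniteDimensional ℝ E] {U : Set E} (hU : Convex ℝ U)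
    (hψ : IsTestFunction (U ∩ (· + h) ⁻¹' U) ψ) : IsTestFunction U (segmentAverage h ψ) where
  contDiff := contDiff_segmentAverage hψ.contDiff hψ.hasCompactSupport
  hasCompactSupport :=
    (hψ.hasCompactSupport.isCompact.add (isCompact_segment 0 h)).of_isClosed_subset
      (isClosed_tsupport _) (tsupport_segmentAverage_subset hψ.hasCompactSupport)
  tsupport_subset := by
    refine (tsupport_segmentAverage_subset hψ.hasCompactSupport).trans ?_
    rintro _ ⟨x, hx, y, hy, rfl⟩
    obtain ⟨hxU, hxhU⟩ := hψ.tsupport_subset hx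
    rw [segment_eq_image'] at hy
    obtain ⟨t, ht, rfl⟩ := hy
    simpa using hU.add_smul_mem hxU hxhU ht
  abs_le_one := abs_segmentAverage_le hψ.abs_le_one

lemma IsTestFunction.fderiv_segmentAverage [FiniteDimensional ℝ E] {V : Set E}
    (hψ : IsTestFunction V ψ) (x : E) :
    fderiv ℝ (_root_.segmentAverage h ψ) x h = ψ x - ψ (x - h) := by
  have hdiff := (contDiff_segmentAverage (h := h) hψ.contDiff hψ.hasCompactSupport).differentiable
    (by simp) x
  rw [← hdiff.lineDeriv_eq_fderiv]
  exact (hasLineDerivAt_segmentAverage hψ.contDiff.continuous x).lineDeriv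

end SegmentAverage

section Translation

variable {E : Type*} [NormedAddCommGroup E] [MeasurableSpace E] [BorelSpace E] {μ : Measure E}
  [μ.IsAddRightInvariant] {U : Set E} {u ψ : E → ℝ}

lemma locallyIntegrableOn_comp_add_right (hu : LocallyIntegrableOn u U μ) (h : E) :
    LocallyIntegrableOn (fun x ↦ u (x + h)) ((· + h) ⁻¹' U) μ := by
  intro x hx
  obtain ⟨t, ht, hut⟩ := hu (x + h) hx
  refine ⟨(· + h) ⁻¹' t, ?_, ?_⟩
  · exact (continuous_add_const h).continuousWithinAt.preimage_mem_nhdsWithin'' ht rfl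
  · exact ((measurePreserving_add_right μ h).integrableOn_comp_preimage
      (measurableEmbedding_addRight h)).2 hut

lemma setIntegral_translate_sub_mul {h : E} (hu : LocallyIntegrableOn u U μ) (hψ : Continuous ψ)
    (hψc : HasCompactSupport ψ) (hψU : tsupport ψ ⊆ U ∩ (· + h) ⁻¹' U) :
    ∫ x in U ∩ (· + h) ⁻¹' U, (u (x + h) - u x) * ψ x ∂μ =
      ∫ x in U, u x * (ψ (x - h) - ψ x) ∂μ := by
  have hψ_zero {x : E} (hx : x ∉ U ∩ (· + h) ⁻¹' U) : ψ x = 0 :=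
    image_eq_zero_of_notMem_tsupport fun h' ↦ hx (hψU h')
  have huψ : Integrable (fun x ↦ u x * ψ x) μ :=
    integrable_mul_of_tsupport_subset hu hψ hψc (hψU.trans inter_subset_left)
  have hu_translate : Integrable (fun x ↦ u (x + h) * ψ x) μ :=
    integrable_mul_of_tsupport_subset (locallyIntegrableOn_comp_add_right hu h) hψ hψc
      (hψU.trans inter_subset_right)
  have hψ_translate : Integrable (fun x ↦ u x * ψ (x - h)) μ := by
    simpa using hu_translate.comp_sub_right h
  calc ∫ x in U ∩ (· + h) ⁻¹' U, (u (x + h) - u x) * ψ x ∂μ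
      = ∫ x, (u (x + h) * ψ x - u x * ψ x) ∂μ := by
        simp only [← sub_mul]
        exact setIntegral_eq_integral_of_forall_compl_eq_zero fun x hx ↦ by
          rw [hψ_zero hx, mul_zero]
    _ = ∫ x, u x * ψ (x - h) ∂μ - ∫ x, u x * ψ x ∂μ := by
        rw [integral_sub hu_translate huψ,
          ← integral_add_right_eq_self (fun x ↦ u x * ψ (x - h)) h]
        simp only [add_sub_cancel_right]
    _ = ∫ x, u x * (ψ (x - h) - ψ x) ∂μ := by
        rw [← integral_sub hψ_translate huψ]
        simp only [mul_sub]
    _ = ∫ x in U, u x * (ψ (x - h) - ψ x) ∂μ := by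
        refine (setIntegral_eq_integral_of_forall_compl_eq_zero fun x hx ↦ ?_).symm
        rw [hψ_zero fun hx' ↦ hx hx'.1, hψ_zero fun hx' ↦ hx (by simpa using hx'.2), sub_zero,
          mul_zero]

end Translation

section IntegrationByParts

variable {E : Type*} [NormedAddCommGroup E] [NormedSpace ℝ E] [MeasurableSpace E] [BorelSpace E]
  {μ : Measure E} {Ω : Set E} {u g : E → ℝ}

lemma integrable_mul_fderiv [IsLocallyFiniteMeasure μ] (hΩ : IsOpen Ω) (hu : ContinuousOn u Ω)
    (hg : ContDiff ℝ 1 g) (hgc : HasCompactSupport g) (hgΩ : tsupport g ⊆ Ω) (v : E) :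
    Integrable (fun x ↦ u x * fderiv ℝ g x v) μ :=
  integrable_mul_of_tsupport_subset (hu.locallyIntegrableOn hΩ.measurableSet)
    ((hg.continuous_fderiv one_ne_zero).clm_apply continuous_const) (hgc.fderiv_apply ℝ v)
    ((tsupport_fderiv_apply_subset ℝ v).trans hgΩ)

lemma integrable_fderiv_mul [IsLocallyFiniteMeasure μ] (hΩ : IsOpen Ω) (hu : ContDiffOn ℝ 1 u Ω)
    (hg : Continuous g) (hgc : HasCompactSupport g) (hgΩ : tsupport g ⊆ Ω) (v : E) :
    Integrable (fun x ↦ fderiv ℝ u x v * g x) μ :=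
  integrable_mul_of_tsupport_subset
    (((hu.continuousOn_fderiv_of_isOpen hΩ le_rfl).clm_apply
      continuousOn_const).locallyIntegrableOn hΩ.measurableSet) hg hgc hgΩ

lemma setIntegral_mul_fderiv_eq_neg [FiniteDimensional ℝ E] [μ.IsAddHaarMeasure]
    (hΩ : IsOpen Ω) (hu : ContDiffOn ℝ 1 u Ω) (hg : ContDiff ℝ 1 g) (hgc : HasCompactSupport g)
    (hgΩ : tsupport g ⊆ Ω) (v : E) :
    ∫ x in Ω, u x * fderiv ℝ g x v ∂μ = -∫ x in Ω, fderiv ℝ u x v * g x ∂μ := by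
  have hg_zero {x : E} (hx : x ∉ Ω) : g x = 0 :=
    image_eq_zero_of_notMem_tsupport fun h ↦ hx (hgΩ h)
  have hfderiv_zero {x : E} (hx : x ∉ Ω) : fderiv ℝ g x = 0 :=
    image_eq_zero_of_notMem_tsupport fun h ↦ hx (hgΩ (tsupport_fderiv_subset ℝ h))
  rw [setIntegral_eq_integral_of_forall_compl_eq_zero fun x hx ↦ by simp [hfderiv_zero hx],
    setIntegral_eq_integral_of_forall_compl_eq_zero fun x hx ↦ by simp [hg_zero hx]]
  exact integral_mul_fderiv_eq_neg_fderiv_mul_of_integrable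
    (integrable_fderiv_mul hΩ hu hg.continuous hgc hgΩ v)
    (integrable_mul_fderiv hΩ hu.continuousOn hg hgc hgΩ v)
    (integrable_mul_of_tsupport_subset (hu.continuousOn.locallyIntegrableOn hΩ.measurableSet)
      hg.continuous hgc hgΩ)
    (fun x hx ↦ (hu.differentiableOn one_ne_zero).differentiableAt (hΩ.mem_nhds (hgΩ hx)))
    (fun x _ ↦ hg.differentiable one_ne_zero x)

end IntegrationByParts

section TotalVariation

variable {d : ℕ} {Ω U : Set (EuclideanSpace ℝ (Fin d))} {u : EuclideanSpace ℝ (Fin d) → ℝ}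

lemma sum_smul_euclideanSpace_single (v : EuclideanSpace ℝ (Fin d)) :
    ∑ i, v i • EuclideanSpace.single i (1 : ℝ) = v := by
  simpa using (EuclideanSpace.basisFun (Fin d) ℝ).sum_repr v

lemma divergence_smul_const {f : EuclideanSpace ℝ (Fin d) → ℝ} {x : EuclideanSpace ℝ (Fin d)}
    (hf : DifferentiableAt ℝ f x) (v : EuclideanSpace ℝ (Fin d)) :
    divergence (fun y ↦ f y • v) x = fderiv ℝ f x v := by
  conv_rhs => rw [← sum_smul_euclideanSpace_single v]
  simp [divergence, fderiv_smul_const hf, mul_comm]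

lemma IsTestFunction.isTestField_smul {f : EuclideanSpace ℝ (Fin d) → ℝ} (hf : IsTestFunction Ω f)
    {v : EuclideanSpace ℝ (Fin d)} (hv : ‖v‖ ≤ 1) : IsTestField Ω fun x ↦ f x • v where
  contDiff := hf.contDiff.smul contDiff_const
  hasCompactSupport := hf.hasCompactSupport.smul_right
  tsupport_subset := (tsupport_smul_subset_left f _).trans hf.tsupport_subset
  norm_le_one x := by
    rw [norm_smul]
    exact mul_le_one₀ (hf.abs_le_one x) (norm_nonneg v) hv

lemma ofReal_setIntegral_mul_divergence_le {φ : EuclideanSpace ℝ (Fin d) → EuclideanSpace ℝ (Fin d)}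
    (u : EuclideanSpace ℝ (Fin d) → ℝ) (hφ : IsTestField Ω φ) :
    ENNReal.ofReal (∫ x in Ω, u x * divergence φ x) ≤ totalVariation u Ω :=
  le_iSup₂_of_le φ hφ le_rfl

lemma ofReal_setIntegral_mul_fderiv_le {f : EuclideanSpace ℝ (Fin d) → ℝ}
    (u : EuclideanSpace ℝ (Fin d) → ℝ) (hf : IsTestFunction Ω f) (v : EuclideanSpace ℝ (Fin d)) :
    ENNReal.ofReal (∫ x in Ω, u x * fderiv ℝ f x v) ≤ ‖v‖ₑ * totalVariation u Ω := by
  have hfd : Differentiable ℝ f := hf.contDiff.differentiable (by simp)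
  rcases eq_or_ne v 0 with rfl | hv
  · simp
  have hfield : IsTestField Ω fun x ↦ f x • (‖v‖⁻¹ • v) :=
    hf.isTestField_smul (norm_smul_inv_norm (𝕜 := ℝ) hv).le
  have hdiv (x : EuclideanSpace ℝ (Fin d)) :
      fderiv ℝ f x v = ‖v‖ * divergence (fun x ↦ f x • (‖v‖⁻¹ • v)) x := by
    rw [divergence_smul_const (hfd x), map_smul, smul_eq_mul,
      mul_inv_cancel_left₀ (norm_ne_zero_iff.2 hv)]
  simp only [hdiv, mul_left_comm (u _)]
  rw [integral_const_mul, ENNReal.ofReal_mul (norm_nonneg v), ofReal_norm]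
  gcongr
  exact ofReal_setIntegral_mul_divergence_le u hfield

lemma setLIntegral_enorm_translate_sub_le (hU : IsOpen U) (hU_convex : Convex ℝ U)
    (hu : LocallyIntegrableOn u U) (h : EuclideanSpace ℝ (Fin d)) :
    ∫⁻ x in U ∩ (· + h) ⁻¹' U, ‖u (x + h) - u x‖ₑ ≤ ‖h‖ₑ * totalVariation u U := by
  have hV : IsOpen (U ∩ (· + h) ⁻¹' U) := hU.inter (hU.preimage (continuous_add_const h))
  have hdiff : LocallyIntegrableOn (fun x ↦ u (x + h) - u x) (U ∩ (· + h) ⁻¹' U) :=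
    ((locallyIntegrableOn_comp_add_right hu h).mono_set inter_subset_right).sub
      (hu.mono_set inter_subset_left)
  refine setLIntegral_enorm_le_of_forall_isTestFunction hV hdiff fun ψ hψ ↦ ?_
  have hderiv (x : EuclideanSpace ℝ (Fin d)) :
      fderiv ℝ (segmentAverage h ψ) x (-h) = ψ (x - h) - ψ x := by
    rw [map_neg, hψ.fderiv_segmentAverage, neg_sub]
  rw [setIntegral_translate_sub_mul hu hψ.contDiff.continuous hψ.hasCompactSupport
    hψ.tsupport_subset, ← enorm_neg h]
  simp only [← hderiv]
  exact ofReal_setIntegral_mul_fderiv_le u (hψ.segmentAverage hU_convex) (-h)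

lemma sum_fderiv_single_mul_eq_inner_gradient (x v : EuclideanSpace ℝ (Fin d)) :
    ∑ i, fderiv ℝ u x (EuclideanSpace.single i 1) * v i = inner ℝ (gradient u x) v := by
  rw [gradient, InnerProductSpace.toDual_symm_apply]
  conv_rhs => rw [← sum_smul_euclideanSpace_single v]
  simp [mul_comm]

lemma divergence_eq_sum_fderiv {φ : EuclideanSpace ℝ (Fin d) → EuclideanSpace ℝ (Fin d)}
    {x : EuclideanSpace ℝ (Fin d)} (hφ : DifferentiableAt ℝ φ x) :
    divergence φ x = ∑ i, fderiv ℝ (fun y ↦ φ y i) x (EuclideanSpace.single i 1) := by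
  refine Finset.sum_congr rfl fun i _ ↦ ?_
  have hcomp := (EuclideanSpace.proj (𝕜 := ℝ) i).hasFDerivAt.comp x hφ.hasFDerivAt
  exact (DFunLike.congr_fun hcomp.fderiv _).symm

lemma setIntegral_mul_divergence_eq_neg_setIntegral_inner_gradient
    {φ : EuclideanSpace ℝ (Fin d) → EuclideanSpace ℝ (Fin d)} (hΩ : IsOpen Ω)
    (hu : ContDiffOn ℝ 1 u Ω) (hφ : ContDiff ℝ 1 φ) (hφc : HasCompactSupport φ)
    (hφΩ : tsupport φ ⊆ Ω) :
    ∫ x in Ω, u x * divergence φ x = -∫ x in Ω, inner ℝ (gradient u x) (φ x) := by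
  have hcomp (i : Fin d) : ContDiff ℝ 1 fun x ↦ φ x i :=
    (EuclideanSpace.proj (𝕜 := ℝ) i).contDiff.comp hφ
  have hcomp_compact (i : Fin d) : HasCompactSupport fun x ↦ φ x i :=
    hφc.comp_left (g := fun v : EuclideanSpace ℝ (Fin d) ↦ v i) rfl
  have hcomp_tsupport (i : Fin d) : tsupport (fun x ↦ φ x i) ⊆ Ω :=
    (tsupport_comp_subset (g := fun v : EuclideanSpace ℝ (Fin d) ↦ v i) rfl φ).trans hφΩ
  simp only [divergence_eq_sum_fderiv (hφ.differentiable one_ne_zero _), Finset.mul_sum,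
    ← sum_fderiv_single_mul_eq_inner_gradient]
  rw [integral_finsetSum _ fun i _ ↦ ?_, integral_finsetSum _ fun i _ ↦ ?_,
    ← Finset.sum_neg_distrib]
  · exact Finset.sum_congr rfl fun i _ ↦ setIntegral_mul_fderiv_eq_neg hΩ hu (hcomp i)
      (hcomp_compact i) (hcomp_tsupport i) _
  · exact (integrable_fderiv_mul hΩ hu (hcomp i).continuous (hcomp_compact i)
      (hcomp_tsupport i) _).integrableOn
  · exact (integrable_mul_fderiv hΩ hu.continuousOn (hcomp i) (hcomp_compact i)
      (hcomp_tsupport i) _).integrableOn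

lemma totalVariation_le_setLIntegral_enorm_gradient (hΩ : IsOpen Ω) (hu : ContDiffOn ℝ 1 u Ω) :
    totalVariation u Ω ≤ ∫⁻ x in Ω, ‖gradient u x‖ₑ := by
  refine iSup₂_le fun φ hφ ↦ ?_
  rw [setIntegral_mul_divergence_eq_neg_setIntegral_inner_gradient hΩ hu
    (hφ.contDiff.of_le (by simp)) hφ.hasCompactSupport hφ.tsupport_subset]
  calc ENNReal.ofReal (-∫ x in Ω, inner ℝ (gradient u x) (φ x))
      ≤ ‖∫ x in Ω, inner ℝ (gradient u x) (φ x)‖ₑ := by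
        rw [Real.enorm_eq_ofReal_abs]
        exact ENNReal.ofReal_le_ofReal (neg_le_abs _)
    _ ≤ ∫⁻ x in Ω, ‖(inner ℝ (gradient u x) (φ x) : ℝ)‖ₑ := enorm_integral_le_lintegral_enorm _
    _ ≤ ∫⁻ x in Ω, ‖gradient u x‖ₑ := by
        refine lintegral_mono fun x ↦ enorm_le_iff_norm_le.2 ?_
        exact (norm_inner_le_norm _ _).trans
          (mul_le_of_le_one_right (norm_nonneg _) (hφ.norm_le_one x))

end TotalVariation

section NonlocalEnergy

lemma lintegral_lintegral_eq_lintegral_translate {G : Type*} [AddCommGroup G] [MeasurableSpace G]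
    [MeasurableAdd₂ G] {μ : Measure G} [SFinite μ] [μ.IsAddRightInvariant] {U : Set G}
    (hU : MeasurableSet U) {F : G × G → ℝ≥0∞}
    (hF : AEMeasurable F ((μ.restrict U).prod (μ.restrict U))) :
    ∫⁻ y in U, ∫⁻ x in U, F (y, x) ∂μ ∂μ =
      ∫⁻ h, ∫⁻ x in U ∩ (· + h) ⁻¹' U, F (x + h, x) ∂μ ∂μ := by
  have hshear := measurePreserving_add_prod μ μ
  have hFU : AEMeasurable ((U ×ˢ U).indicator F) (μ.prod μ) :=
    (aemeasurable_indicator_iff (hU.prod hU)).2 (by rwa [← Measure.prod_restrict])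
  calc ∫⁻ y in U, ∫⁻ x in U, F (y, x) ∂μ ∂μ = ∫⁻ p in U ×ˢ U, F p ∂μ.prod μ := by
        rw [← lintegral_prod _ hF, Measure.prod_restrict]
    _ = ∫⁻ p, (U ×ˢ U).indicator F p ∂μ.prod μ := (lintegral_indicator (hU.prod hU) F).symm
    _ = ∫⁻ p, (U ×ˢ U).indicator F (p.1 + p.2, p.2) ∂μ.prod μ := by
        rw [← lintegral_map' (by rwa [hshear.map_eq]) hshear.aemeasurable, hshear.map_eq]
    _ = ∫⁻ h, ∫⁻ x, (U ×ˢ U).indicator F (h + x, x) ∂μ ∂μ :=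
        lintegral_prod _ (hFU.comp_quasiMeasurePreserving hshear.quasiMeasurePreserving)
    _ = ∫⁻ h, ∫⁻ x in U ∩ (· + h) ⁻¹' U, F (x + h, x) ∂μ ∂μ := by
        refine lintegral_congr fun h ↦ ?_
        rw [← lintegral_indicator (hU.inter (measurable_add_const h hU))]
        refine lintegral_congr fun x ↦ ?_
        rw [add_comm h x]
        by_cases hx : x ∈ U ∩ (· + h) ⁻¹' U
        · rw [indicator_of_mem hx, indicator_of_mem (mem_prod.2 ⟨hx.2, hx.1⟩)]
        · rw [indicator_of_notMem hx, indicator_of_notMem fun hxU ↦ hx ⟨hxU.2, hxU.1⟩]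

variable {d : ℕ} {Ω U : Set (EuclideanSpace ℝ (Fin d))} {K : EuclideanSpace ℝ (Fin d) → ℝ≥0}
  {u : EuclideanSpace ℝ (Fin d) → ℝ}

lemma nonlocalEnergy1_eq_lintegral_translate (hU : MeasurableSet U) (hK : AEMeasurable K)
    (hu : AEMeasurable u (volume.restrict U)) :
    nonlocalEnergy1 K u U =
      ∫⁻ h, (K h : ℝ≥0∞) * ∫⁻ x in U ∩ (· + h) ⁻¹' U, ‖u (x + h) - u x‖ₑ := by
  have hK_sub : AEMeasurable (fun p : EuclideanSpace ℝ (Fin d) × EuclideanSpace ℝ (Fin d) ↦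
      (K (p.1 - p.2) : ℝ≥0∞)) ((volume.restrict U).prod (volume.restrict U)) := by
    rw [Measure.prod_restrict]
    exact (hK.comp_quasiMeasurePreserving
      (quasiMeasurePreserving_sub volume volume)).coe_nnreal_ennreal.restrict
  have hu_sub : AEMeasurable (fun p : EuclideanSpace ℝ (Fin d) × EuclideanSpace ℝ (Fin d) ↦
      ‖u p.1 - u p.2‖ₑ) ((volume.restrict U).prod (volume.restrict U)) :=
    ((hu.comp_quasiMeasurePreserving Measure.quasiMeasurePreserving_fst).sub
      (hu.comp_quasiMeasurePreserving Measure.quasiMeasurePreserving_snd)).enorm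
  refine (lintegral_lintegral_eq_lintegral_translate hU (hK_sub.mul hu_sub)).trans ?_
  simp only [Pi.mul_apply, add_sub_cancel_left, lintegral_const_mul' _ _ ENNReal.coe_ne_top]

lemma nonlocalEnergy1_le_firstMoment_mul_totalVariation (hU : IsOpen U) (hU_convex : Convex ℝ U)
    (hK : AEMeasurable K) (hu : LocallyIntegrableOn u U) :
    nonlocalEnergy1 K u U ≤ firstMoment K * totalVariation u U :=
  calc nonlocalEnergy1 K u U
      = ∫⁻ h, (K h : ℝ≥0∞) * ∫⁻ x in U ∩ (· + h) ⁻¹' U, ‖u (x + h) - u x‖ₑ :=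
        nonlocalEnergy1_eq_lintegral_translate hU.measurableSet hK
          hu.aestronglyMeasurable.aemeasurable
    _ ≤ ∫⁻ h, (K h : ℝ≥0∞) * ‖h‖ₑ * totalVariation u U := by
        simp only [mul_assoc]
        gcongr with h
        exact setLIntegral_enorm_translate_sub_le hU hU_convex hu h
    _ = firstMoment K * totalVariation u U :=
        lintegral_mul_const'' _ (hK.coe_nnreal_ennreal.mul measurable_enorm.aemeasurable)

lemma nonlocalEnergy_le_nonlocalEnergy1_univ (hΩ : MeasurableSet Ω)
    (K : EuclideanSpace ℝ (Fin d) → ℝ≥0) (u : EuclideanSpace ℝ (Fin d) → ℝ) :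
    nonlocalEnergy K u Ω ≤ nonlocalEnergy1 K u univ :=
  calc nonlocalEnergy K u Ω ≤ nonlocalEnergy1 K u Ω + nonlocalEnergy2 K u Ω := by
        unfold nonlocalEnergy
        gcongr
        exact mul_le_of_le_one_left' (by simp)
    _ ≤ ∫⁻ y in Ω, ((∫⁻ x in Ω, (K (y - x) : ℝ≥0∞) * ‖u y - u x‖ₑ)
          + ∫⁻ x in Ωᶜ, (K (y - x) : ℝ≥0∞) * ‖u y - u x‖ₑ) := le_lintegral_add _ _
    _ = ∫⁻ y in Ω, ∫⁻ x, (K (y - x) : ℝ≥0∞) * ‖u y - u x‖ₑ := by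
        simp only [lintegral_add_compl _ hΩ]
    _ ≤ nonlocalEnergy1 K u univ := by
        simp only [nonlocalEnergy1, Measure.restrict_univ]
        exact setLIntegral_le_lintegral _ _

lemma nonlocalEnergy_le_firstMoment_mul_totalVariation (hΩ : MeasurableSet Ω)
    (hK : AEMeasurable K) (hu : LocallyIntegrable u) :
    nonlocalEnergy K u Ω ≤ firstMoment K * totalVariation u univ :=
  (nonlocalEnergy_le_nonlocalEnergy1_univ hΩ K u).trans
    (nonlocalEnergy1_le_firstMoment_mul_totalVariation isOpen_univ convex_univ hK
      (hu.locallyIntegrableOn univ))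

end NonlocalEnergy

theorem mainTheorem11_general {d : ℕ} {Ω : Set (EuclideanSpace ℝ (Fin d))} (hΩ : MeasurableSet Ω)
    {K : EuclideanSpace ℝ (Fin d) → ℝ≥0} (hK : AEMeasurable K) :
    (IsOpen Ω → Convex ℝ Ω → ∀ u : EuclideanSpace ℝ (Fin d) → ℝ, LocallyIntegrableOn u Ω →
      nonlocalEnergy1 K u Ω ≤ firstMoment K * totalVariation u Ω) ∧
    (∀ u : EuclideanSpace ℝ (Fin d) → ℝ, ContDiff ℝ 1 u →
      nonlocalEnergy K u Ω ≤ firstMoment K * ∫⁻ x, ‖gradient u x‖ₑ) ∧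
    (∀ u : EuclideanSpace ℝ (Fin d) → ℝ, LocallyIntegrable u →
      nonlocalEnergy K u Ω ≤ firstMoment K * totalVariation u univ) := by
  refine ⟨fun hΩ_open hΩ_convex u hu ↦
      nonlocalEnergy1_le_firstMoment_mul_totalVariation hΩ_open hΩ_convex hK hu,
    fun u hu ↦ ?_, fun u hu ↦ nonlocalEnergy_le_firstMoment_mul_totalVariation hΩ hK hu⟩
  calc nonlocalEnergy K u Ω ≤ firstMoment K * totalVariation u univ :=
        nonlocalEnergy_le_firstMoment_mul_totalVariation hΩ hK hu.continuous.locallyIntegrable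
    _ ≤ firstMoment K * ∫⁻ x, ‖gradient u x‖ₑ := by
        gcongr
        simpa using totalVariation_le_setLIntegral_enorm_gradient isOpen_univ hu.contDiffOn

theorem mainTheorem11 (d : ℕ) (hd : 1 ≤ d)
    (Ω : Set (EuclideanSpace ℝ (Fin d))) (hΩ : IsLipschitzDomain Ω)
    (K : EuclideanSpace ℝ (Fin d) → ℝ≥0) (hK : IsAdmissibleKernel K) :
    (Convex ℝ Ω → ∀ u : EuclideanSpace ℝ (Fin d) → ℝ, IsBV u Ω →
      nonlocalEnergy1 K u Ω ≤ firstMoment K * totalVariation u Ω) ∧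
    (∀ u : EuclideanSpace ℝ (Fin d) → ℝ, ContDiff ℝ 1 u → IsBV u univ →
      nonlocalEnergy K u Ω ≤ firstMoment K * ∫⁻ x, ‖gradient u x‖ₑ) ∧
    (∀ u : EuclideanSpace ℝ (Fin d) → ℝ, IsBV u univ →
      nonlocalEnergy K u Ω ≤ firstMoment K * totalVariation u univ) :=
  have ⟨hconvex, hsmooth, hglobal⟩ :=
    mainTheorem11_general hΩ.isOpen.measurableSet hK.aemeasurable
  ⟨fun hΩ_convex u hu ↦ hconvex hΩ.isOpen hΩ_convex u hu.integrableOn.locallyIntegrableOn,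
    fun u hu _ ↦ hsmooth u hu,
    fun u hu ↦ hglobal u (integrableOn_univ.1 hu.integrableOn).locallyIntegrable⟩
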